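/- Let $d\ge 0$, let $P$ be a polynomial in $d$ variables with complex coefficients, and let $P(\partial)$ be the corresponding constant coefficient differential operator on $\mathbb R^d$, so that $P(\partial)e^{i\lambda\cdot x}=P(i\lambda)e^{i\lambda\cdot x}$. Put $\mathcal F f(\lambda)=(2\pi)^{-d/2}\int_{\mathbb R^d}f(x)e^{-i\lambda\cdot x}\,dx$. Let $\widetilde T_1$ be the operator on $L^1(\mathbb R^d)$ whose domain consists of all $f\in L^1(\mathbb R^d)$ for which the tempered distribution $P(\partial)f$ belongs to $L^1(\mathbb R^d)$, with $\widetilde T_1f=P(\partial)f$; its powers $\widetilde T_1^n$ are defined on their natural domains. For an operator $T$ on a complex Banach space $X$ with domain $D_T$ and for $x\in X$, the local resolvent set $\rho_T(x)$ consists of all $z_0\in\mathbb C$ for which there are an open neighbourhood $U$ of $z_0$ and an analytic map $\phi:U\to X$, $z\mapsto\phi_z$, with $\phi_z\in D_T$ and $(T-z)\phi_z=x$ for all $z\in U$; the local spectrum is $\sigma_T(x)=\mathbb C\setminus\rho_T(x)$. The operator $T$ has the single-valued extension property (SVEP) if, for every non-empty open $U\subseteq\mathbb C$, the only analytic $\phi:U\to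 X$ with $\phi_z\in D_T$ and $(T-z)\phi_z=0$ for all $z\in U$ is $\phi=0$. Then $\widetilde T_1$ is closed and has SVEP. Moreover, every Schwartz function $f\in\mathcal S(\mathbb R^d)$ lies in the domain of $\widetilde T_1$, with $\widetilde T_1 f$ equal to the classical $P(\partial)f$, and $$\sigma_{\widetilde T_1}(f)=\overline{\{P(i\lambda):\lambda\in\operatorname{supp}\mathcal F f\}}.$$ Furthermore, such an $f$ lies in the domain of $\widetilde T_1^n$ with $\widetilde T_1^nf=P(\partial)^nf$ for all $n\ge 0$, and in $[0,\infty]$ the limit of $\|\widetilde T_1^nf\|_1^{1/n}$ exists and $$\lim_{n\to\infty}\|\widetilde T_1^nf\|_1^{1/n}=\sup\{|P(i\lambda)|:\lambda\in\operatorname{supp}\mathcal F f\}=\sup\{|z|:z\in\sigma_{\widetilde T_1}(f)\},$$ where the supremum of the empty set is $0$. -/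

import Mathlib

open MeasureTheory Filter Topology
open scoped SchwartzMap LineDeriv ENNReal

noncomputable section

/-- Euclidean space `ℝ^d`. -/
abbrev Euc (d : ℕ) : Type := EuclideanSpace ℝ (Fin d)

/-- The Banach space `L¹(ℝ^d)` of (classes of) complex-valued integrable functions. -/
abbrev L1 (d : ℕ) : Type := Lp ℂ 1 (volume : Measure (Euc d))

section Operators

variable {d : ℕ} {V : Type*} [AddCommGroup V] [Module ℂ V]
  [LineDeriv (Euc d) V V] [LineDerivAdd (Euc d) V V] [LineDerivSMul ℂ (Euc d) V V]

/-- The `j`-th partial derivative `∂_j`, as a linear endomorphism of a space `V` of functions or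
distributions on `ℝ^d`. -/
def partialDeriv (j : Fin d) : Module.End ℂ V where
  toFun u := ∂_{(EuclideanSpace.single j (1 : ℝ) : Euc d)} u
  map_add' := LineDeriv.lineDerivOp_add _
  map_smul' := LineDeriv.lineDerivOp_smul _

/-- `∂^α = ∂_1^{α_1} ⋯ ∂_d^{α_d}` for a multi-index `α`. -/
def multiDeriv (α : Fin d →₀ ℕ) : Module.End ℂ V :=
  (List.ofFn fun j : Fin d => (partialDeriv j : Module.End ℂ V) ^ α j).prod

/-- The constant coefficient differential operator `P(∂) = ∑_α c_α ∂^α` attached to the complex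
polynomial `P = ∑_α c_α X^α`. It is used for `V = 𝓢(ℝ^d)` and for `V = 𝓢'(ℝ^d)`. -/
def diffOp (P : MvPolynomial (Fin d) ℂ) : Module.End ℂ V :=
  ∑ α ∈ P.support, P.coeff α • multiDeriv α

end Operators

/-- The value `P(iξ)`, for `ξ ∈ ℝ^d`. -/
def symbol {d : ℕ} (P : MvPolynomial (Fin d) ℂ) (ξ : Euc d) : ℂ :=
  MvPolynomial.eval (fun j => Complex.I * (ξ j : ℂ)) P

/-- The Fourier transform `ξ ↦ (2π)^{-d/2} ∫ f(x) e^{-i ξ·x} dx`. -/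
def fourierTr {d : ℕ} (f : Euc d → ℂ) (ξ : Euc d) : ℂ :=
  (((2 * Real.pi) ^ (-(d : ℝ) / 2) : ℝ) : ℂ) *
    ∫ x : Euc d, f x * Complex.exp (-(Complex.I * ((∑ j, ξ j * x j : ℝ) : ℂ)))

section ClosedExtension

variable {d : ℕ}

/-- The set of all pairs `(f, g)` in `L¹ × L¹` such that `P(∂) f = g` as tempered distributions. -/
def l1Graph (P : MvPolynomial (Fin d) ℂ) : Submodule ℂ (L1 d × L1 d) where
  carrier := {q | diffOp P (Lp.toTemperedDistributionCLM ℂ volume 1 q.1) =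
    Lp.toTemperedDistributionCLM ℂ volume 1 q.2}
  add_mem' := by
    intro a b ha hb
    simp only [Set.mem_ofPred_eq, Prod.fst_add, Prod.snd_add, map_add] at *
    rw [ha, hb]
  zero_mem' := by
    simp only [Set.mem_ofPred_eq, Prod.fst_zero, Prod.snd_zero, map_zero]
  smul_mem' := by
    intro c a ha
    simp only [Set.mem_ofPred_eq, Prod.smul_fst, Prod.smul_snd, map_smul] at *
    rw [ha]

theorem l1Graph_functional (P : MvPolynomial (Fin d) ℂ) :
    ∀ q ∈ l1Graph P, q.1 = 0 → q.2 = 0 := by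
  intro q hq h0
  have hq' : diffOp P (Lp.toTemperedDistributionCLM ℂ volume 1 q.1) =
    Lp.toTemperedDistributionCLM ℂ volume 1 q.2 := hq
  rw [h0, map_zero, map_zero] at hq'
  have hk := Lp.ker_toTemperedDistributionCLM_eq_bot (E := Euc d) (F := ℂ)
    (μ := volume) (p := 1)
  rw [LinearMap.ker_eq_bot'] at hk
  exact hk q.2 hq'.symm

/-- The operator `T̃₁` on `L¹(ℝ^d)`: its domain consists of all `f ∈ L¹` such that the tempered
distribution `P(∂) f` belongs to `L¹`, and `T̃₁ f = P(∂) f`. -/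
def closedExt (P : MvPolynomial (Fin d) ℂ) : L1 d →ₗ.[ℂ] L1 d :=
  (l1Graph P).toLinearPMap

theorem closedExt_graph (P : MvPolynomial (Fin d) ℂ) : (closedExt P).graph = l1Graph P :=
  Submodule.toLinearPMap_graph_eq _ (l1Graph_functional P)

theorem mem_domain_closedExt (P : MvPolynomial (Fin d) ℂ) (f : L1 d) :
    f ∈ (closedExt P).domain ↔ ∃ g : L1 d,
      diffOp P (Lp.toTemperedDistributionCLM ℂ volume 1 f) =
        Lp.toTemperedDistributionCLM ℂ volume 1 g := by
  constructor
  · intro h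
    have h1 := (closedExt P).mem_graph ⟨f, h⟩
    rw [closedExt_graph] at h1
    exact ⟨_, h1⟩
  · rintro ⟨g, hg⟩
    have h1 : (f, g) ∈ (closedExt P).graph := by
      rw [closedExt_graph]
      exact hg
    exact LinearPMap.mem_domain_of_mem_graph h1

theorem closedExt_apply (P : MvPolynomial (Fin d) ℂ) (f : (closedExt P).domain) :
    Lp.toTemperedDistributionCLM ℂ volume 1 (closedExt P f) =
      diffOp P (Lp.toTemperedDistributionCLM ℂ volume 1 (f : L1 d)) := by
  have h1 := (closedExt P).mem_graph f
  rw [closedExt_graph] at h1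
  exact Eq.symm h1

end ClosedExtension

section LocalSpectralTheory

variable {X : Type*} [NormedAddCommGroup X] [NormedSpace ℂ X]

/-- The composition `S ∘ T` of unbounded operators, on its natural domain
`{x ∈ D(T) : T x ∈ D(S)}`. -/
def unbComp (S T : X →ₗ.[ℂ] X) : X →ₗ.[ℂ] X where
  domain :=
    { carrier := {x | ∃ h : x ∈ T.domain, T ⟨x, h⟩ ∈ S.domain}
      add_mem' := by
        rintro a b ⟨ha, ha'⟩ ⟨hb, hb'⟩
        refine ⟨T.domain.add_mem ha hb, ?_⟩
        have h := T.map_add ⟨a, ha⟩ ⟨b, hb⟩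
        rw [AddMemClass.mk_add_mk] at h
        rw [h]
        exact S.domain.add_mem ha' hb'
      zero_mem' := by
        refine ⟨T.domain.zero_mem, ?_⟩
        have h := T.map_zero
        change T ⟨0, _⟩ = 0 at h
        rw [h]
        exact S.domain.zero_mem
      smul_mem' := by
        rintro c a ⟨ha, ha'⟩
        refine ⟨T.domain.smul_mem c ha, ?_⟩
        have h := T.map_smul c ⟨a, ha⟩
        rw [SetLike.mk_smul_mk] at h
        rw [h]
        exact S.domain.smul_mem c ha' }
  toFun :=
    { toFun := fun x => S ⟨T ⟨x, x.2.fst⟩, x.2.snd⟩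
      map_add' := by
        intro x y
        rw [← S.map_add]
        congr 1
        apply Subtype.ext
        exact T.map_add ⟨x, x.2.fst⟩ ⟨y, y.2.fst⟩
      map_smul' := by
        intro c x
        rw [RingHom.id_apply, ← S.map_smul]
        congr 1
        apply Subtype.ext
        exact T.map_smul c ⟨x, x.2.fst⟩ }

/-- The powers `T^n` of an unbounded operator: `T^0` is the identity on all of `X` and
`T^{n+1} = T ∘ T^n` on its natural domain. -/
def unbPow (T : X →ₗ.[ℂ] X) : ℕ → (X →ₗ.[ℂ] X)
  | 0 => ⟨⊤, (⊤ : Submodule ℂ X).subtype⟩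
  | n + 1 => unbComp T (unbPow T n)

/-- The local resolvent set `ρ_T(x)`: all `z₀ ∈ ℂ` having an open neighbourhood `U` on which there
is an analytic `X`-valued `φ` with values in `D(T)` such that `(T - z) φ_z = x` for `z ∈ U`. -/
def localResolventSet (T : X →ₗ.[ℂ] X) (x : X) : Set ℂ :=
  {z₀ | ∃ U : Set ℂ, IsOpen U ∧ z₀ ∈ U ∧ ∃ φ : ℂ → X, AnalyticOnNhd ℂ φ U ∧
    ∀ z ∈ U, ∃ h : φ z ∈ T.domain, T ⟨φ z, h⟩ - z • φ z = x}

/-- The local spectrum `σ_T(x)`. -/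
def localSpectrum (T : X →ₗ.[ℂ] X) (x : X) : Set ℂ :=
  (localResolventSet T x)ᶜ

/-- The single-valued extension property. -/
def HasSVEP (T : X →ₗ.[ℂ] X) : Prop :=
  ∀ U : Set ℂ, IsOpen U → U.Nonempty → ∀ φ : ℂ → X, AnalyticOnNhd ℂ φ U →
    (∀ z ∈ U, ∃ h : φ z ∈ T.domain, T ⟨φ z, h⟩ - z • φ z = 0) → ∀ z ∈ U, φ z = 0

end LocalSpectralTheory

end

open scoped FourierTransform

noncomputable section

/-! ### `P(∂)` as multiplication on the Fourier side. -/

section FourierSide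

variable {d : ℕ}

/-! Write `m` for `multiplier P` and `f^` for the Fourier transform. Each evaluation `f ↦ f^(ξ)` is
a continuous functional on L¹, and the graph of the operator is exactly the set of pairs with `m f^
= g^` pointwise (`mem_l1Graph_iff`). Closedness is then immediate. For SVEP, `(m(ξ) - z) φ_z^(ξ) =
0` forces `φ_z^(ξ) = 0` for `z ≠ m(ξ)`, and continuity in `z` covers the remaining point.

The analytic core is `exists_norm_toLp_fourierInv_smulLeftCLM_pow_le`: if `|h| ≤ A` on the support
of a Schwartz function `g`, then the L¹ norm of the inverse transform of `h^n g` is at most `A^n`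
times a polynomial in `n`. With `h = (m - z₀)⁻¹` near a support on which `|m - z₀| ≥ δ`, it makes a
Neumann series for the local resolvent converge. With `h = m` and `g = f^`, it gives the upper bound
for the growth of `‖P(∂)^n f‖₁`.

The opposite bounds are pointwise: a local resolvent at `z = m(η)` would force `f^(η) = 0`, and
`|m(η)|^n |f^(η)| ≤ ‖P(∂)^n f‖₁`. -/

/-- The Fourier multiplier of `P(∂)`, in the normalization `e^{-2πi⟨x, ξ⟩}` of `𝓕`. -/
def multiplier (P : MvPolynomial (Fin d) ℂ) (ξ : Euc d) : ℂ :=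
  symbol P ((2 * Real.pi) • ξ)

theorem hasTemperateGrowth_coord (j : Fin d) :
    (fun ξ : Euc d => Complex.I * (((2 * Real.pi) • ξ) j : ℂ)).HasTemperateGrowth := by
  have h : (fun ξ : Euc d => Complex.I * (((2 * Real.pi) • ξ) j : ℂ)) =
      (((2 * Real.pi : ℝ) : ℂ) * Complex.I) •
        (Complex.ofRealCLM ∘L (EuclideanSpace.proj j : Euc d →L[ℝ] ℝ)) := by
    ext ξ
    simp
    ring
  rw [h]
  exact (Function.HasTemperateGrowth.const _).smul (ContinuousLinearMap.hasTemperateGrowth _)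

theorem hasTemperateGrowth_coord_pow (j : Fin d) (n : ℕ) :
    (fun ξ : Euc d => (Complex.I * (((2 * Real.pi) • ξ) j : ℂ)) ^ n).HasTemperateGrowth :=
  (hasTemperateGrowth_coord j).pow n

theorem multiplier_eq_sum (P : MvPolynomial (Fin d) ℂ) (ξ : Euc d) :
    multiplier P ξ = ∑ α ∈ P.support, P.coeff α *
      ((List.finRange d).map fun j => (Complex.I * (((2 * Real.pi) • ξ) j : ℂ)) ^ α j).prod := by
  rw [multiplier, symbol, MvPolynomial.eval_eq']
  refine Finset.sum_congr rfl fun α _ => ?_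
  rw [← List.ofFn_eq_map, List.prod_ofFn]

theorem hasTemperateGrowth_listProd (α : Fin d →₀ ℕ) (l : List (Fin d)) :
    (fun ξ : Euc d =>
      (l.map fun j => (Complex.I * (((2 * Real.pi) • ξ) j : ℂ)) ^ α j).prod).HasTemperateGrowth := by
  induction l with
  | nil => simp
  | cons j l ih =>
    simp only [List.map_cons, List.prod_cons]
    exact ((hasTemperateGrowth_coord j).pow _).mul ih

theorem hasTemperateGrowth_multiplier (P : MvPolynomial (Fin d) ℂ) :
    (multiplier P).HasTemperateGrowth := by
  rw [show multiplier P = _ from funext (multiplier_eq_sum P)]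
  exact Function.HasTemperateGrowth.sum fun α _ =>
    (Function.HasTemperateGrowth.const _).mul (hasTemperateGrowth_listProd α _)

theorem fourier_partialDeriv (j : Fin d) (u : 𝓢'(Euc d, ℂ)) :
    𝓕 (partialDeriv j u) =
      TemperedDistribution.smulLeftCLM ℂ
        (fun ξ : Euc d => Complex.I * (((2 * Real.pi) • ξ) j : ℂ)) (𝓕 u) := by
  change 𝓕 (∂_{(EuclideanSpace.single j (1 : ℝ) : Euc d)} u) = _
  rw [TemperedDistribution.fourier_lineDerivOp_eq]
  have h := Function.hasTemperateGrowth_inner_left (EuclideanSpace.single j (1 : ℝ) : Euc d)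
  have h' : (fun ξ : Euc d => ((inner ℝ ξ (EuclideanSpace.single j (1 : ℝ)) : ℝ) : ℂ)).HasTemperateGrowth :=
    Function.Complex.hasTemperateGrowth_ofReal.comp h
  rw [← smul_apply, ← TemperedDistribution.smulLeftCLM_smul h']
  congr 2
  ext ξ
  simp [EuclideanSpace.inner_single_right]
  ring

theorem fourier_partialDeriv_pow (j : Fin d) (n : ℕ) (u : 𝓢'(Euc d, ℂ)) :
    𝓕 (((partialDeriv j : Module.End ℂ 𝓢'(Euc d, ℂ)) ^ n) u) =
      TemperedDistribution.smulLeftCLM ℂ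
        (fun ξ : Euc d => (Complex.I * (((2 * Real.pi) • ξ) j : ℂ)) ^ n) (𝓕 u) := by
  induction n with
  | zero => simp
  | succ n ih =>
    rw [pow_succ', Module.End.mul_apply, fourier_partialDeriv, ih,
      TemperedDistribution.smulLeftCLM_smulLeftCLM_apply (hasTemperateGrowth_coord_pow j n)
        (hasTemperateGrowth_coord j)]
    congr 2

theorem fourier_multiDeriv (α : Fin d →₀ ℕ) (u : 𝓢'(Euc d, ℂ)) :
    𝓕 (multiDeriv α u) = TemperedDistribution.smulLeftCLM ℂ
      (fun ξ : Euc d => ((List.finRange d).map fun j =>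
        (Complex.I * (((2 * Real.pi) • ξ) j : ℂ)) ^ α j).prod) (𝓕 u) := by
  rw [multiDeriv, List.ofFn_eq_map]
  induction List.finRange d with
  | nil => simp
  | cons j l ih =>
    rw [List.map_cons, List.prod_cons, Module.End.mul_apply, fourier_partialDeriv_pow, ih,
      TemperedDistribution.smulLeftCLM_smulLeftCLM_apply (hasTemperateGrowth_listProd α l)
        (hasTemperateGrowth_coord_pow j _)]
    congr 2
    ext ξ
    simp [mul_comm]

theorem fourier_diffOp (P : MvPolynomial (Fin d) ℂ) (u : 𝓢'(Euc d, ℂ)) :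
    𝓕 (diffOp P u) = TemperedDistribution.smulLeftCLM ℂ (multiplier P) (𝓕 u) := by
  rw [show multiplier P = _ from funext (multiplier_eq_sum P),
    TemperedDistribution.smulLeftCLM_sum (g := fun (α : Fin d →₀ ℕ) (ξ : Euc d) => P.coeff α *
      ((List.finRange d).map fun j => (Complex.I * (((2 * Real.pi) • ξ) j : ℂ)) ^ α j).prod)
      (fun α _ => (Function.HasTemperateGrowth.const _).mul (hasTemperateGrowth_listProd α _)),
    diffOp, LinearMap.sum_apply]
  change FourierTransform.fourierCLM ℂ _ _ = _
  rw [map_sum, _root_.sum_apply]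
  refine Finset.sum_congr rfl fun α _ => ?_
  rw [LinearMap.smul_apply, map_smul]
  change _ • 𝓕 (multiDeriv α u) = TemperedDistribution.smulLeftCLM ℂ (P.coeff α • _) (𝓕 u)
  rw [fourier_multiDeriv, TemperedDistribution.smulLeftCLM_smul (hasTemperateGrowth_listProd α _),
    smul_apply]

/-! ### The pointwise Fourier transform on L¹. -/

/-- The Fourier transform at a point, as a continuous linear functional on `L¹(ℝ^d)`. -/
def fourierAt (ξ : Euc d) : L1 d →L[ℂ] ℂ :=
  LinearMap.mkContinuous
    { toFun := fun f => 𝓕 (f : Euc d → ℂ) ξ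
      map_add' := by
        intro f g
        have hf := L1.integrable_coeFn f
        have hg := L1.integrable_coeFn g
        simp only [Real.fourier_eq]
        rw [← integral_add ((Real.fourierIntegral_convergent_iff ξ).2 hf)
          ((Real.fourierIntegral_convergent_iff ξ).2 hg)]
        refine integral_congr_ae ?_
        filter_upwards [Lp.coeFn_add f g] with x hx
        rw [hx, Pi.add_apply, smul_add]
      map_smul' := by
        intro c f
        simp only [Real.fourier_eq, RingHom.id_apply]
        rw [← integral_smul]
        refine integral_congr_ae ?_
        filter_upwards [Lp.coeFn_smul c f] with x hx
        rw [hx, Pi.smul_apply, smul_comm] } 1 (by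
    intro f
    simp only [LinearMap.coe_mk, AddHom.coe_mk, one_mul]
    rw [L1.norm_eq_integral_norm]
    exact VectorFourier.norm_fourierIntegral_le_integral_norm _ _ _ _ _)

theorem fourierAt_apply (ξ : Euc d) (f : L1 d) : fourierAt ξ f = 𝓕 (f : Euc d → ℂ) ξ := rfl

theorem norm_fourierAt_le (ξ : Euc d) (f : L1 d) : ‖fourierAt ξ f‖ ≤ ‖f‖ := by
  rw [L1.norm_eq_integral_norm]
  exact VectorFourier.norm_fourierIntegral_le_integral_norm _ _ _ _ _

theorem fourierAt_toLp (ξ : Euc d) (f : 𝓢(Euc d, ℂ)) :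
    fourierAt ξ (f.toLp 1 volume) = 𝓕 f ξ := by
  rw [fourierAt_apply, SchwartzMap.fourier_coe]
  simp only [Real.fourier_eq]
  refine integral_congr_ae ?_
  filter_upwards [f.coeFn_toLp 1 volume] with x hx
  rw [hx]

theorem continuous_fourierAt (f : L1 d) : Continuous fun ξ => fourierAt ξ f :=
  VectorFourier.fourierIntegral_continuous Real.continuous_fourierChar
    (L := innerₗ (Euc d)) continuous_inner (L1.integrable_coeFn f)

theorem fourier_toTemperedDistribution_apply (f : L1 d) (ψ : 𝓢(Euc d, ℂ)) :
    𝓕 (Lp.toTemperedDistributionCLM ℂ volume 1 f) ψ = ∫ ξ, ψ ξ • fourierAt ξ f := by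
  rw [TemperedDistribution.fourier_apply, Lp.toTemperedDistributionCLM_apply,
    Lp.toTemperedDistribution_apply]
  have h := VectorFourier.integral_fourierIntegral_smul_eq_flip (L := innerₗ (Euc d))
    (μ := volume) (ν := volume) Real.continuous_fourierChar continuous_inner
    (ψ.integrable (μ := volume)) (L1.integrable_coeFn f)
  simpa using! h

/-- The Fourier transform is injective on tempered distributions, so the defining equation may be
tested after it. Both sides are then continuous functions with equal integrals against test
functions, so they agree almost everywhere, hence everywhere. -/
theorem mem_l1Graph_iff (P : MvPolynomial (Fin d) ℂ) (q : L1 d × L1 d) :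
    q ∈ l1Graph P ↔ ∀ ξ, multiplier P ξ * fourierAt ξ q.1 = fourierAt ξ q.2 := by
  have hP := hasTemperateGrowth_multiplier P
  have key : q ∈ l1Graph P ↔ ∀ ψ : 𝓢(Euc d, ℂ),
      ∫ ξ, ψ ξ • (multiplier P ξ * fourierAt ξ q.1) = ∫ ξ, ψ ξ • fourierAt ξ q.2 := by
    change diffOp P (Lp.toTemperedDistributionCLM ℂ volume 1 q.1) =
      Lp.toTemperedDistributionCLM ℂ volume 1 q.2 ↔ _
    have hinj : Function.Injective (𝓕 : 𝓢'(Euc d, ℂ) → 𝓢'(Euc d, ℂ)) :=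
      (FourierTransform.fourierEquiv ℂ 𝓢'(Euc d, ℂ)).injective
    rw [← hinj.eq_iff, fourier_diffOp, DFunLike.ext_iff]
    refine forall_congr' fun ψ => ?_
    rw [TemperedDistribution.smulLeftCLM_apply_apply, fourier_toTemperedDistribution_apply,
      fourier_toTemperedDistribution_apply]
    simp only [SchwartzMap.smulLeftCLM_apply_apply hP, smul_eq_mul]
    simp only [mul_assoc, mul_left_comm]
  rw [key]
  refine ⟨fun h => ?_, fun h ψ => by simp only [h]⟩
  have c1 : Continuous fun ξ => multiplier P ξ * fourierAt ξ q.1 :=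
    hP.1.continuous.mul (continuous_fourierAt q.1)
  have c2 := continuous_fourierAt q.2
  have hae := ae_eq_of_integral_contDiff_smul_eq (μ := (volume : Measure (Euc d)))
    c1.locallyIntegrable c2.locallyIntegrable fun g hg hc => by
      have hg₁ : HasCompactSupport (Complex.ofRealCLM ∘ g) := hc.comp_left rfl
      have hg₂ : ContDiff ℝ (⊤ : ℕ∞) (Complex.ofRealCLM ∘ g) := Complex.ofRealCLM.contDiff.comp hg
      simpa using h (hg₁.toSchwartzMap hg₂)
  exact congrFun ((Continuous.ae_eq_iff_eq volume c1 c2).1 hae)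

end FourierSide

/-! ### Growth of powers of a multiplier, and a tempered extension of the inverse. -/

section MultiplierGrowth

universe u

theorem SchwartzMap.seminorm_succ_eq {E F : Type*} [NormedAddCommGroup E] [NormedSpace ℝ E]
    [NormedAddCommGroup F] [NormedSpace ℝ F] [NormedSpace ℂ F] [SMulCommClass ℝ ℂ F]
    (k l : ℕ) (f : 𝓢(E, F)) :
    SchwartzMap.seminorm ℂ k (l + 1) f =
      SchwartzMap.seminorm ℂ k l (SchwartzMap.fderivCLM ℂ E F f) := by
  have h : ∀ x, ‖iteratedFDeriv ℝ l (SchwartzMap.fderivCLM ℂ E F f) x‖ =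
      ‖iteratedFDeriv ℝ (l + 1) f x‖ := fun x => norm_iteratedFDeriv_fderiv
  apply le_antisymm
  · refine SchwartzMap.seminorm_le_bound ℂ _ _ _ (apply_nonneg _ _) fun x => ?_
    rw [← h]
    exact SchwartzMap.le_seminorm ℂ k l _ x
  · refine SchwartzMap.seminorm_le_bound ℂ _ _ _ (apply_nonneg _ _) fun x => ?_
    rw [h]
    exact SchwartzMap.le_seminorm ℂ k (l + 1) _ x

theorem Function.HasTemperateGrowth.fderiv {E F : Type*} [NormedAddCommGroup E] [NormedSpace ℝ E]
    [NormedAddCommGroup F] [NormedSpace ℝ F] {f : E → F} (hf : f.HasTemperateGrowth) :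
    (fun x => _root_.fderiv ℝ f x).HasTemperateGrowth := by
  refine ⟨hf.1.fderiv_right (m := (⊤ : ℕ∞)) (by simp), fun n => ?_⟩
  obtain ⟨k, C, h⟩ := hf.2 (n + 1)
  exact ⟨k, C, fun x => norm_iteratedFDeriv_fderiv.trans_le (h x)⟩

variable {E : Type u} [NormedAddCommGroup E] [NormedSpace ℝ E]

/-- The product of a Schwartz function with the differential of a scalar function of temperate
growth, `x ↦ (v ↦ (Dh(x) v) • g x)`. -/
def fderivSMul {F : Type*} [NormedAddCommGroup F] [NormedSpace ℂ F] {h : E → ℂ}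
    (hh : h.HasTemperateGrowth) (g : 𝓢(E, F)) : 𝓢(E, E →L[ℝ] F) :=
  SchwartzMap.bilinLeftCLM
    ((ContinuousLinearMap.compL ℝ E ℂ F) ∘L (ContinuousLinearMap.lsmul ℝ ℂ).flip) hh.fderiv g

theorem fderivSMul_apply {F : Type*} [NormedAddCommGroup F] [NormedSpace ℂ F] {h : E → ℂ}
    (hh : h.HasTemperateGrowth) (g : 𝓢(E, F)) (x v : E) :
    fderivSMul hh g x v = fderiv ℝ h x v • g x := rfl

theorem tsupport_fderivSMul_subset {F : Type*} [NormedAddCommGroup F] [NormedSpace ℂ F] {h : E → ℂ}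
    (hh : h.HasTemperateGrowth) (g : 𝓢(E, F)) : tsupport (fderivSMul hh g) ⊆ tsupport g := by
  refine closure_mono fun x hx => ?_
  contrapose! hx
  rw [Function.notMem_support] at hx ⊢
  ext v
  rw [fderivSMul_apply, hx, smul_zero]
  rfl

theorem fderivCLM_smulLeftCLM_pow {F : Type*} [NormedAddCommGroup F] [NormedSpace ℂ F] {h : E → ℂ}
    (hh : h.HasTemperateGrowth) (g : 𝓢(E, F)) (n : ℕ) :
    SchwartzMap.fderivCLM ℂ E F (SchwartzMap.smulLeftCLM F (h ^ n) g) =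
      SchwartzMap.smulLeftCLM _ (h ^ n) (SchwartzMap.fderivCLM ℂ E F g) +
        (n : ℂ) • SchwartzMap.smulLeftCLM _ (h ^ (n - 1)) (fderivSMul hh g) := by
  ext x v
  have hd : HasFDerivAt h (fderiv ℝ h x) x :=
    (hh.1.differentiable (by simp)).differentiableAt.hasFDerivAt
  have hg := (g.differentiableAt (x := x)).hasFDerivAt
  have := ((hd.pow n).smul hg).fderiv
  rw [SchwartzMap.fderivCLM_apply, SchwartzMap.smulLeftCLM_apply (hh.pow n)]
  simp only [add_apply, smul_apply,
    SchwartzMap.smulLeftCLM_apply_apply (hh.pow _), SchwartzMap.fderivCLM_apply]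
  change fderiv ℝ (fun x => (h ^ n) x • g x) x v = _
  have e : (fun x => (h ^ n) x • g x) = ((fun x => h x ^ n) • g) := rfl
  rw [e, this]
  simp [fderivSMul_apply, smul_smul, mul_assoc]

/-- Induction on `l` through `D(h^n g) = h^n Dg + n h^(n-1) Dh·g`: `Dg` and `Dh·g` are Schwartz
functions supported in the support of `g`, so each derivative costs one factor `n + 1`. The target
space becomes `E →L[ℝ] F` at each step, hence `F` is generalized and shares the universe of `E`. -/
theorem exists_seminorm_smulLeftCLM_pow_le {h : E → ℂ} (hh : h.HasTemperateGrowth) {A : ℝ}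
    (hA : 0 < A) (k l : ℕ) {F : Type u} [NormedAddCommGroup F] [NormedSpace ℂ F] (g : 𝓢(E, F))
    (hg : ∀ x ∈ tsupport g, ‖h x‖ ≤ A) :
    ∃ C, 0 ≤ C ∧ ∀ n : ℕ, SchwartzMap.seminorm ℂ k l (SchwartzMap.smulLeftCLM F (h ^ n) g) ≤
      C * (n + 1) ^ l * A ^ n := by
  induction l generalizing F with
  | zero =>
    refine ⟨SchwartzMap.seminorm ℂ k 0 g, apply_nonneg _ _, fun n => ?_⟩
    refine SchwartzMap.seminorm_le_bound ℂ _ _ _ (by positivity) fun x => ?_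
    rw [norm_iteratedFDeriv_zero, SchwartzMap.smulLeftCLM_apply_apply (hh.pow n), norm_smul,
      pow_zero, mul_one, Pi.pow_apply, norm_pow]
    by_cases hx : x ∈ tsupport g
    · have h1 := SchwartzMap.le_seminorm ℂ k 0 g x
      rw [norm_iteratedFDeriv_zero] at h1
      calc ‖x‖ ^ k * (‖h x‖ ^ n * ‖g x‖) = (‖x‖ ^ k * ‖g x‖) * ‖h x‖ ^ n := by ring
        _ ≤ _ := by gcongr; exact hg x hx
    · rw [image_eq_zero_of_notMem_tsupport hx, norm_zero, mul_zero, mul_zero]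
      positivity
  | succ l ih =>
    obtain ⟨C₁, hC₁, h₁⟩ := ih (SchwartzMap.fderivCLM ℂ E F g)
      fun x hx => hg x (SchwartzMap.tsupport_fderivCLM_subset ℂ g hx)
    obtain ⟨C₂, hC₂, h₂⟩ := ih (fderivSMul hh g)
      fun x hx => hg x (tsupport_fderivSMul_subset hh g hx)
    -- The term with `h^(n-1)` is one factor `A` short, hence `C₂ / A`; for `n = 0` its coefficient
    -- vanishes.
    refine ⟨C₁ + C₂ / A, by positivity, fun n => ?_⟩
    rw [SchwartzMap.seminorm_succ_eq, fderivCLM_smulLeftCLM_pow hh]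
    refine (map_add_le_add _ _ _).trans ?_
    rw [map_smul_eq_mul, Complex.norm_natCast]
    have e1 : SchwartzMap.seminorm ℂ k l
        (SchwartzMap.smulLeftCLM _ (h ^ n) (SchwartzMap.fderivCLM ℂ E F g)) ≤
        C₁ * (n + 1) ^ (l + 1) * A ^ n := by
      refine (h₁ n).trans ?_
      gcongr
      · linarith [Nat.cast_nonneg (α := ℝ) n]
      · omega
    have e2 : n * SchwartzMap.seminorm ℂ k l
        (SchwartzMap.smulLeftCLM _ (h ^ (n - 1)) (fderivSMul hh g)) ≤
        C₂ / A * (n + 1) ^ (l + 1) * A ^ n := by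
      rcases n with _ | n
      · simp
        positivity
      · calc _ ≤ ((n + 1 : ℕ) : ℝ) * (C₂ * (n + 1) ^ l * A ^ n) := by
              gcongr
              exact h₂ n
          _ = C₂ / A * ((n + 1) * (n + 1) ^ l) * A ^ (n + 1) := by
              push_cast
              field_simp
              ring
          _ ≤ C₂ / A * (((n + 1 : ℕ) + 1) * ((n + 1 : ℕ) + 1) ^ l) * A ^ (n + 1) := by
              push_cast
              gcongr <;> linarith
          _ = _ := by ring
    linarith

/-- The L¹ norm of the inverse transform is a continuous seminorm on Schwartz space, so finitely
many Schwartz seminorms dominate it; `m` is the largest derivative order among them. -/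
theorem exists_norm_toLp_fourierInv_smulLeftCLM_pow_le {d : ℕ} {h : Euc d → ℂ}
    (hh : h.HasTemperateGrowth) {A : ℝ} (hA : 0 < A) (g : 𝓢(Euc d, ℂ))
    (hg : ∀ x ∈ tsupport g, ‖h x‖ ≤ A) :
    ∃ (C : ℝ) (m : ℕ), 0 ≤ C ∧ ∀ n : ℕ,
      ‖(𝓕⁻ (SchwartzMap.smulLeftCLM ℂ (h ^ n) g)).toLp 1 volume‖ ≤ C * (n + 1) ^ m * A ^ n := by
  let L : 𝓢(Euc d, ℂ) →L[ℂ] L1 d :=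
    SchwartzMap.toLpCLM ℂ ℂ 1 volume ∘L FourierTransform.fourierInvCLM ℂ 𝓢(Euc d, ℂ)
  let q : Seminorm ℂ 𝓢(Euc d, ℂ) := (normSeminorm ℂ (L1 d)).comp L.toLinearMap
  have hq : Continuous q := continuous_norm.comp L.continuous
  obtain ⟨s, C, -, hC⟩ := Seminorm.bound_of_continuous (schwartz_withSeminorms ℂ (Euc d) ℂ) q hq
  choose c hc0 hc using fun i : ℕ × ℕ =>
    exists_seminorm_smulLeftCLM_pow_le hh hA i.1 i.2 g hg
  refine ⟨C * ∑ i ∈ s, c i, s.sup Prod.snd,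
    mul_nonneg C.2 (Finset.sum_nonneg fun i _ => hc0 i), fun n => ?_⟩
  calc _ ≤ C * (s.sup (schwartzSeminormFamily ℂ (Euc d) ℂ))
        (SchwartzMap.smulLeftCLM ℂ (h ^ n) g) := hC _
    _ ≤ C * ∑ i ∈ s, c i * (n + 1) ^ (s.sup Prod.snd) * A ^ n := by
      gcongr
      refine (Seminorm.finset_sup_le_sum _ s _).trans ?_
      rw [sum_apply]
      refine Finset.sum_le_sum fun i hi => (hc i n).trans ?_
      have := hc0 i
      gcongr
      · linarith [Nat.cast_nonneg (α := ℝ) n]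
      · exact Finset.le_sup (f := Prod.snd) hi
    _ = _ := by simp only [Finset.sum_mul, Finset.mul_sum, mul_assoc]

/-- The function `w ↦ w⁻¹` outside a disk about the origin extends to one of temperate growth. -/
theorem exists_hasTemperateGrowth_eq_inv {δ : ℝ} (hδ : 0 < δ) :
    ∃ ψ : ℂ → ℂ, ψ.HasTemperateGrowth ∧ ∀ w, δ ≤ ‖w‖ → ψ w = w⁻¹ := by
  have hr0 : 0 < (1 + δ ^ 2)⁻¹ := by positivity
  have hr1 : (1 + δ ^ 2)⁻¹ < 1 := inv_lt_one_of_one_lt₀ (by nlinarith)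
  -- With `u = (1 + |w|²)⁻¹` one has `u / (1 - u) = |w|⁻²`, so `conj w · u / (1 - u) = w⁻¹`. The
  -- singularity `u = 1` is the point `w = 0`; the bump is `1` on the values of `u` coming from `|w|
  -- ≥ δ`, and its outer radius is the midpoint between `(1 + δ²)⁻¹` and `1`.
  let b : ContDiffBump (0 : ℝ) := ⟨(1 + δ ^ 2)⁻¹, (1 + (1 + δ ^ 2)⁻¹) / 2, hr0, by linarith⟩
  let κ : ℝ → ℝ := fun u => b u * (u / (1 - u))
  have hκc : HasCompactSupport κ := b.hasCompactSupport.mul_right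
  have hκs : ContDiff ℝ (⊤ : ℕ∞) κ := by
    rw [contDiff_iff_contDiffAt]
    intro u
    by_cases hu : u = 1
    · have h1 : u ∉ tsupport b := by
        rw [b.tsupport_eq, mem_closedBall_zero_iff, hu, norm_one]
        change ¬ (1 ≤ (1 + (1 + δ ^ 2)⁻¹) / 2)
        linarith
      have h2 : κ =ᶠ[𝓝 u] fun _ => 0 := by
        filter_upwards [(isClosed_tsupport b).isOpen_compl.mem_nhds h1] with v hv
        simp [κ, image_eq_zero_of_notMem_tsupport hv]
      exact contDiffAt_const.congr_of_eventuallyEq h2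
    · exact b.contDiff.contDiffAt.mul
        (contDiffAt_id.div (contDiffAt_const.sub contDiffAt_id) (sub_ne_zero.2 (Ne.symm hu)))
  have hκ : κ.HasTemperateGrowth := hκc.hasTemperateGrowth hκs
  refine ⟨fun w => (starRingEnd ℂ) w * (κ ((1 + ‖w‖ ^ 2) ^ (-1 : ℝ)) : ℂ), ?_, fun w hw => ?_⟩
  · refine Function.HasTemperateGrowth.mul
      (Complex.conjCLE.toContinuousLinearMap.hasTemperateGrowth) ?_
    exact Function.Complex.hasTemperateGrowth_ofReal.comp
      (hκ.comp (Function.hasTemperateGrowth_one_add_norm_sq_rpow ℂ (-1)))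
  · have hw0 : 0 < ‖w‖ := hδ.trans_le hw
    have hu : (1 + ‖w‖ ^ 2)⁻¹ ≤ (1 + δ ^ 2)⁻¹ := by gcongr
    have hb : b ((1 + ‖w‖ ^ 2)⁻¹) = 1 := by
      apply b.one_of_mem_closedBall
      rw [mem_closedBall_zero_iff, Real.norm_of_nonneg (by positivity)]
      exact hu
    have hk : κ ((1 + ‖w‖ ^ 2)⁻¹) = (‖w‖ ^ 2)⁻¹ := by
      simp only [κ, hb, one_mul]
      have : 1 - (1 + ‖w‖ ^ 2)⁻¹ ≠ 0 := by linarith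
      field_simp
      ring
    simp only [Real.rpow_neg_one, hk, Complex.inv_def, Complex.normSq_eq_norm_sq]

end MultiplierGrowth

/-! ### Closedness and SVEP from the pointwise description. -/

section LocalSpectrum

variable {d : ℕ} (P : MvPolynomial (Fin d) ℂ)

theorem closedExt_apply_eq_iff (x y : L1 d) :
    (∃ h : x ∈ (closedExt P).domain, closedExt P ⟨x, h⟩ = y) ↔
      ∀ ξ, multiplier P ξ * fourierAt ξ x = fourierAt ξ y := by
  rw [← mem_l1Graph_iff P (x, y), ← closedExt_graph, LinearPMap.mem_graph_iff]
  constructor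
  · rintro ⟨h, e⟩
    exact ⟨⟨x, h⟩, rfl, e⟩
  · rintro ⟨⟨w, hw⟩, e, e'⟩
    obtain rfl : w = x := e
    exact ⟨hw, e'⟩

theorem closedExt_sub_smul_eq_iff (x y : L1 d) (z : ℂ) :
    (∃ h : x ∈ (closedExt P).domain, closedExt P ⟨x, h⟩ - z • x = y) ↔
      ∀ ξ, (multiplier P ξ - z) * fourierAt ξ x = fourierAt ξ y := by
  simp only [sub_eq_iff_eq_add]
  rw [closedExt_apply_eq_iff]
  refine forall_congr' fun ξ => ?_
  rw [map_add, map_smul, smul_eq_mul, sub_mul, sub_eq_iff_eq_add]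

/-- Injectivity of the Fourier transform on L¹: the hypothesis puts `(0, x)` in the graph of an
operator. The polynomial `0` is an arbitrary choice. -/
theorem eq_zero_of_fourierAt_eq_zero {x : L1 d} (h : ∀ ξ, fourierAt ξ x = 0) : x = 0 :=
  l1Graph_functional 0 (0, x)
    ((mem_l1Graph_iff 0 _).2 fun ξ => by rw [map_zero, mul_zero, h]) rfl

theorem isClosed_closedExt : (closedExt P).IsClosed := by
  have h : ((closedExt P).graph : Set (L1 d × L1 d)) =
      ⋂ ξ, {q | multiplier P ξ * fourierAt ξ q.1 = fourierAt ξ q.2} := by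
    ext q
    rw [closedExt_graph, SetLike.mem_coe, mem_l1Graph_iff, Set.mem_iInter]
    rfl
  change IsClosed ((closedExt P).graph : Set (L1 d × L1 d))
  rw [h]
  exact isClosed_iInter fun ξ => isClosed_eq (by fun_prop) (by fun_prop)

theorem hasSVEP_closedExt : HasSVEP (closedExt P) := by
  intro U hU _ φ hφ h z hz
  refine eq_zero_of_fourierAt_eq_zero fun ξ => ?_
  have key : ∀ w ∈ U, w ≠ multiplier P ξ → fourierAt ξ (φ w) = 0 := by
    intro w hw hne
    have := (closedExt_sub_smul_eq_iff P (φ w) 0 w).1 (h w hw) ξ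
    rw [map_zero] at this
    exact (mul_eq_zero.1 this).resolve_left (sub_ne_zero.2 hne.symm)
  by_cases hzp : z = multiplier P ξ
  · have hc : ContinuousAt (fun w => fourierAt ξ (φ w)) z :=
      (fourierAt ξ).continuous.continuousAt.comp (hφ z hz).continuousAt
    have h0 : Tendsto (fun w => fourierAt ξ (φ w)) (𝓝[≠] z) (𝓝 0) := by
      refine tendsto_const_nhds.congr' ?_
      filter_upwards [self_mem_nhdsWithin, mem_nhdsWithin_of_mem_nhds (hU.mem_nhds hz)]
        with w hw hwU
      exact (key w hwU (hzp ▸ hw)).symm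
    exact tendsto_nhds_unique (hc.tendsto.mono_left nhdsWithin_le_nhds) h0
  · exact key z hz hzp

/-! ### Schwartz functions: domains, powers and the local spectrum. -/

theorem partialDeriv_toTemperedDistributionCLM (j : Fin d) (f : 𝓢(Euc d, ℂ)) :
    partialDeriv j (SchwartzMap.toTemperedDistributionCLM (Euc d) ℂ volume f) =
      SchwartzMap.toTemperedDistributionCLM (Euc d) ℂ volume (partialDeriv j f) :=
  TemperedDistribution.lineDerivOp_toTemperedDistributionCLM_eq f _

theorem partialDeriv_pow_toTemperedDistributionCLM (j : Fin d) (n : ℕ) (f : 𝓢(Euc d, ℂ)) :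
    (partialDeriv j ^ n : Module.End ℂ _)
        (SchwartzMap.toTemperedDistributionCLM (Euc d) ℂ volume f) =
      SchwartzMap.toTemperedDistributionCLM (Euc d) ℂ volume
        ((partialDeriv j ^ n : Module.End ℂ _) f) := by
  induction n with
  | zero => rfl
  | succ n ih =>
    rw [pow_succ', pow_succ', Module.End.mul_apply, Module.End.mul_apply, ih,
      partialDeriv_toTemperedDistributionCLM]

theorem multiDeriv_toTemperedDistributionCLM (α : Fin d →₀ ℕ) (f : 𝓢(Euc d, ℂ)) :
    multiDeriv α (SchwartzMap.toTemperedDistributionCLM (Euc d) ℂ volume f) =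
      SchwartzMap.toTemperedDistributionCLM (Euc d) ℂ volume (multiDeriv α f) := by
  rw [multiDeriv, multiDeriv, List.ofFn_eq_map, List.ofFn_eq_map]
  induction List.finRange d with
  | nil => rfl
  | cons j l ih =>
    rw [List.map_cons, List.prod_cons, List.map_cons, List.prod_cons, Module.End.mul_apply,
      Module.End.mul_apply, ih, partialDeriv_pow_toTemperedDistributionCLM]

theorem diffOp_toTemperedDistributionCLM (f : 𝓢(Euc d, ℂ)) :
    diffOp P (SchwartzMap.toTemperedDistributionCLM (Euc d) ℂ volume f) =
      SchwartzMap.toTemperedDistributionCLM (Euc d) ℂ volume (diffOp P f) := by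
  simp only [diffOp, LinearMap.sum_apply, LinearMap.smul_apply, map_sum, map_smul,
    multiDeriv_toTemperedDistributionCLM]

theorem closedExt_toLp (f : 𝓢(Euc d, ℂ)) :
    ∃ h : f.toLp 1 volume ∈ (closedExt P).domain,
      closedExt P ⟨f.toLp 1 volume, h⟩ = (diffOp P f).toLp 1 volume := by
  rw [closedExt_apply_eq_iff, ← mem_l1Graph_iff P (_, _)]
  change diffOp P (Lp.toTemperedDistributionCLM ℂ volume 1 _) =
    Lp.toTemperedDistributionCLM ℂ volume 1 _
  simp only [Lp.toTemperedDistributionCLM_apply, Lp.toTemperedDistribution_toLp_eq]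
  exact diffOp_toTemperedDistributionCLM P f

theorem fourier_diffOp_schwartz (f : 𝓢(Euc d, ℂ)) (ξ : Euc d) :
    𝓕 (diffOp P f) ξ = multiplier P ξ * 𝓕 f ξ := by
  rw [← fourierAt_toLp, ← fourierAt_toLp]
  exact ((closedExt_apply_eq_iff P _ _).1 (closedExt_toLp P f) ξ).symm

theorem fourier_diffOp_pow_schwartz (f : 𝓢(Euc d, ℂ)) (n : ℕ) (ξ : Euc d) :
    𝓕 ((diffOp P ^ n) f) ξ = multiplier P ξ ^ n * 𝓕 f ξ := by
  induction n with
  | zero => simp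
  | succ n ih =>
    rw [pow_succ', Module.End.mul_apply, fourier_diffOp_schwartz, ih]
    ring

theorem diffOp_pow_eq_fourierInv (f : 𝓢(Euc d, ℂ)) (n : ℕ) :
    (diffOp P ^ n) f = 𝓕⁻ (SchwartzMap.smulLeftCLM ℂ (multiplier P ^ n) (𝓕 f)) := by
  rw [← FourierTransform.fourierInv_fourier_eq (F := 𝓢(Euc d, ℂ)) ((diffOp P ^ n) f)]
  congr 1
  ext ξ
  rw [fourier_diffOp_pow_schwartz,
    SchwartzMap.smulLeftCLM_apply_apply ((hasTemperateGrowth_multiplier P).pow n)]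
  rfl

theorem unbPow_closedExt_toLp (f : 𝓢(Euc d, ℂ)) (n : ℕ) :
    ∃ h : f.toLp 1 volume ∈ (unbPow (closedExt P) n).domain,
      unbPow (closedExt P) n ⟨f.toLp 1 volume, h⟩ = ((diffOp P ^ n) f).toLp 1 volume := by
  induction n with
  | zero => exact ⟨Submodule.mem_top, rfl⟩
  | succ n ih =>
    obtain ⟨h, e⟩ := ih
    obtain ⟨h', e'⟩ := closedExt_toLp P ((diffOp P ^ n) f)
    refine ⟨⟨h, e ▸ h'⟩, ?_⟩
    rw [pow_succ', Module.End.mul_apply, ← e']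
    change closedExt P ⟨unbPow (closedExt P) n ⟨_, h⟩, _⟩ = _
    congr 2

theorem exists_ne_zero_of_mem_tsupport {X M : Type*} [TopologicalSpace X] [Zero M] {g : X → M}
    {x : X} (hx : x ∈ tsupport g) {V : Set X} (hV : V ∈ 𝓝 x) : ∃ y ∈ V, g y ≠ 0 := by
  obtain ⟨y, hy, hy'⟩ := mem_closure_iff_nhds.1 hx V hV
  exact ⟨y, hy, hy'⟩

/-- The resolvent is the Neumann series `∑ (z - z₀)^n a n`, where `a n` has Fourier transform
`h^(n+1) f^`. The function `h` must be tempered on all of space although `m - z₀` may vanish off the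
support of `f^`, hence the modified inverse `ψ`. -/
theorem exists_resolvent_of_notMem_closure (f : 𝓢(Euc d, ℂ)) {z₀ : ℂ}
    (hz₀ : z₀ ∉ closure (multiplier P '' tsupport (𝓕 f : 𝓢(Euc d, ℂ)))) :
    z₀ ∈ localResolventSet (closedExt P) (f.toLp 1 volume) := by
  obtain ⟨δ, hδ, hK⟩ : ∃ δ > 0, ∀ ξ ∈ tsupport (𝓕 f : 𝓢(Euc d, ℂ)), δ ≤ ‖multiplier P ξ - z₀‖ := by
    rw [Metric.mem_closure_iff] at hz₀
    push Not at hz₀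
    obtain ⟨δ, hδ, h⟩ := hz₀
    refine ⟨δ, hδ, fun ξ hξ => ?_⟩
    have := h _ (Set.mem_image_of_mem _ hξ)
    rwa [dist_comm, dist_eq_norm] at this
  obtain ⟨ψ, hψ, hψi⟩ := exists_hasTemperateGrowth_eq_inv hδ
  let h : Euc d → ℂ := fun ξ => ψ (multiplier P ξ - z₀)
  have hh : h.HasTemperateGrowth :=
    hψ.comp ((hasTemperateGrowth_multiplier P).sub (.const z₀))
  have hhK : ∀ ξ ∈ tsupport (𝓕 f : 𝓢(Euc d, ℂ)), h ξ = (multiplier P ξ - z₀)⁻¹ := fun ξ hξ => hψi _ (hK ξ hξ)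
  have hhA : ∀ ξ ∈ tsupport (𝓕 f : 𝓢(Euc d, ℂ)), ‖h ξ‖ ≤ δ⁻¹ := by
    intro ξ hξ
    rw [hhK ξ hξ, norm_inv]
    exact inv_anti₀ hδ (hK ξ hξ)
  let g : 𝓢(Euc d, ℂ) := SchwartzMap.smulLeftCLM ℂ h (𝓕 f)
  obtain ⟨C, m, hC, hb⟩ := exists_norm_toLp_fourierInv_smulLeftCLM_pow_le hh
    (inv_pos.2 hδ) g fun ξ hξ => hhA ξ (SchwartzMap.tsupport_smulLeftCLM_subset _ _ hξ).1
  let a : ℕ → L1 d := fun n => (𝓕⁻ (SchwartzMap.smulLeftCLM ℂ (h ^ n) g)).toLp 1 volume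
  have ha : ∀ n ξ, fourierAt ξ (a n) = h ξ ^ n * (h ξ * 𝓕 f ξ) := by
    intro n ξ
    rw [fourierAt_toLp, FourierTransform.fourier_fourierInv_eq,
      SchwartzMap.smulLeftCLM_apply_apply (hh.pow n), SchwartzMap.smulLeftCLM_apply_apply hh]
    rfl
  let u : ℕ → ℝ := fun n => C * ((n + 1) ^ m * (1 / 2) ^ n)
  have hu : Summable u := by
    refine Summable.mul_left _ ?_
    have h1 := summable_pow_mul_geometric_of_norm_lt_one (R := ℝ) m (r := 1 / 2) (by norm_num)
    -- The factor `2` restores the power of `1/2` lost in the shift from `n` to `n + 1`.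
    refine (((summable_nat_add_iff 1).2 h1).mul_left 2).congr fun n => ?_
    push_cast
    ring
  -- Half the distance `δ` gives ratio `1/2`, which absorbs the polynomial factor uniformly in `z`.
  let U := Metric.ball z₀ (δ / 2)
  have hbound : ∀ n, ∀ z ∈ U, ‖(z - z₀) ^ n • a n‖ ≤ u n := by
    intro n z hz
    rw [mem_ball_iff_norm] at hz
    rw [norm_smul, norm_pow]
    calc _ ≤ (δ / 2) ^ n * (C * (n + 1) ^ m * δ⁻¹ ^ n) := by
          gcongr
          exact hb n
      _ = C * ((n + 1) ^ m * (δ / 2 * δ⁻¹) ^ n) := by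
          rw [mul_pow]
          ring
      _ = u n := by
          rw [show δ / 2 * δ⁻¹ = 1 / 2 by field_simp]
  refine ⟨U, Metric.isOpen_ball, Metric.mem_ball_self (by positivity),
    fun z => ∑' n, (z - z₀) ^ n • a n, ?_, fun z hz => ?_⟩
  · refine DifferentiableOn.analyticOnNhd ?_ Metric.isOpen_ball
    exact Complex.differentiableOn_tsum_of_summable_norm hu
      (fun n => by fun_prop) Metric.isOpen_ball hbound
  · rw [closedExt_sub_smul_eq_iff]
    intro ξ
    have hs : Summable fun n => (z - z₀) ^ n • a n :=
      Summable.of_norm_bounded hu fun n => hbound n z hz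
    rw [ContinuousLinearMap.map_tsum _ hs, fourierAt_toLp]
    simp only [map_smul, ha, smul_eq_mul]
    by_cases hξ : ξ ∈ tsupport (𝓕 f : 𝓢(Euc d, ℂ))
    · have hne : multiplier P ξ - z₀ ≠ 0 := norm_pos_iff.1 (hδ.trans_le (hK ξ hξ))
      have hz' : ‖z - z₀‖ < δ / 2 := mem_ball_iff_norm.1 hz
      have hlt : ‖(z - z₀) * h ξ‖ < 1 := by
        rw [norm_mul]
        calc ‖z - z₀‖ * ‖h ξ‖ ≤ δ / 2 * δ⁻¹ := by
              gcongr
              exact hhA ξ hξ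
          _ < 1 := by
              rw [show δ / 2 * δ⁻¹ = 1 / 2 by field_simp]
              norm_num
      have hne' : multiplier P ξ - z ≠ 0 := by
        intro h0
        have := hK ξ hξ
        rw [sub_eq_zero.1 h0] at this
        linarith
      simp only [← mul_assoc, ← mul_pow]
      rw [tsum_mul_right, tsum_mul_right, tsum_geometric_of_norm_lt_one hlt, hhK ξ hξ]
      have e : 1 - (z - z₀) * (multiplier P ξ - z₀)⁻¹ =
          (multiplier P ξ - z) * (multiplier P ξ - z₀)⁻¹ := by
        field_simp
        ring
      rw [e]
      field_simp
    · simp [image_eq_zero_of_notMem_tsupport hξ]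

theorem localSpectrum_closedExt_toLp (f : 𝓢(Euc d, ℂ)) :
    localSpectrum (closedExt P) (f.toLp 1 volume) =
      closure (multiplier P '' tsupport (𝓕 f : 𝓢(Euc d, ℂ))) := by
  apply Set.Subset.antisymm
  · intro z hz
    by_contra h
    exact hz (exists_resolvent_of_notMem_closure P f h)
  · rintro z hz ⟨U, hU, hzU, φ, -, h⟩
    obtain ⟨_, hU', ξ, hξ, rfl⟩ := mem_closure_iff.1 hz U hU hzU
    -- A point of the closed support need not satisfy `f^ ≠ 0`; a nearby `η` does, with `m(η)` still
    -- in `U`.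
    obtain ⟨η, hη, hne⟩ := exists_ne_zero_of_mem_tsupport hξ
      ((hasTemperateGrowth_multiplier P).1.continuous.continuousAt (hU.mem_nhds hU'))
    have := (closedExt_sub_smul_eq_iff P _ _ _).1 (h _ hη) η
    rw [sub_self, zero_mul, fourierAt_toLp] at this
    exact hne this.symm

/-! ### The growth rate of `‖P(∂)^n f‖₁`. -/

theorem tendsto_const_rpow_one_div {c : ℝ} (hc : 0 < c) :
    Tendsto (fun n : ℕ => c ^ (1 / (n : ℝ))) atTop (𝓝 1) := by
  have := (Real.continuousAt_const_rpow (b := 0) hc.ne').tendsto.comp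
    tendsto_one_div_atTop_nhds_zero_nat
  simpa using! this

theorem tendsto_add_one_rpow_one_div :
    Tendsto (fun n : ℕ => ((n : ℝ) + 1) ^ (1 / (n : ℝ))) atTop (𝓝 1) := by
  have h := (tendsto_rpow_div_mul_add 1 1 (-1) (by norm_num)).comp
    (tendsto_atTop_add_const_right atTop (1 : ℝ) tendsto_natCast_atTop_atTop)
  -- At `x = n + 1` the exponent `1 / (1 * x + (-1))` is `1 / n`.
  simpa [Function.comp_def] using h

theorem tendsto_enorm_diffOp_pow (f : 𝓢(Euc d, ℂ)) :
    Tendsto (fun n : ℕ => ‖((diffOp P ^ n) f).toLp 1 volume‖ₑ ^ (1 / (n : ℝ))) atTop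
      (𝓝 (⨆ ξ ∈ tsupport (𝓕 f : 𝓢(Euc d, ℂ)), ‖multiplier P ξ‖ₑ)) := by
  rw [tendsto_order]
  constructor
  · intro b hb
    simp only [lt_iSup_iff] at hb
    obtain ⟨ξ, hξ, hb⟩ := hb
    have hc : Continuous fun ξ => ‖multiplier P ξ‖ₑ :=
      (hasTemperateGrowth_multiplier P).1.continuous.enorm
    obtain ⟨η, hη, hne⟩ := exists_ne_zero_of_mem_tsupport hξ
      (hc.continuousAt (lt_mem_nhds hb))
    have hlim : Tendsto (fun n : ℕ => ENNReal.ofReal (‖multiplier P η‖ *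
        ‖𝓕 f η‖ ^ (1 / (n : ℝ)))) atTop (𝓝 ‖multiplier P η‖ₑ) := by
      rw [← ofReal_norm]
      refine (ENNReal.continuous_ofReal.tendsto _).comp ?_
      simpa using (tendsto_const_rpow_one_div (norm_pos_iff.2 hne)).const_mul ‖multiplier P η‖
    filter_upwards [hlim.eventually (lt_mem_nhds hη), eventually_gt_atTop 0] with n hn hn0
    refine hn.trans_le ?_
    have h1 : ‖multiplier P η‖ ^ n * ‖𝓕 f η‖ ≤ ‖((diffOp P ^ n) f).toLp 1 volume‖ := by
      rw [← norm_pow, ← norm_mul, ← fourier_diffOp_pow_schwartz, ← fourierAt_toLp]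
      exact norm_fourierAt_le _ _
    rw [← ofReal_norm, ENNReal.ofReal_rpow_of_nonneg (norm_nonneg _) (by positivity)]
    apply ENNReal.ofReal_le_ofReal
    calc _ = (‖multiplier P η‖ ^ n * ‖𝓕 f η‖) ^ (1 / (n : ℝ)) := by
          rw [Real.mul_rpow (by positivity) (by positivity), one_div,
            Real.pow_rpow_inv_natCast (norm_nonneg _) hn0.ne']
      _ ≤ _ := by gcongr
  · intro b hb
    -- `A` lies strictly above the supremum, so it is positive even when the supremum is `0`. An
    -- infinite supremum leaves no `b` to treat.
    obtain ⟨A, hA, hAb⟩ := ENNReal.lt_iff_exists_nnreal_btwn.1 hb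
    have hA0 : 0 < (A : ℝ) := by
      have : (0 : ℝ≥0∞) < A := bot_le.trans_lt hA
      exact_mod_cast this
    have hK : ∀ ξ ∈ tsupport (𝓕 f : 𝓢(Euc d, ℂ)), ‖multiplier P ξ‖ ≤ A := by
      intro ξ hξ
      have h1 : ‖multiplier P ξ‖ₑ ≤ A := (le_iSup₂ (f := fun ξ _ => ‖multiplier P ξ‖ₑ) ξ hξ).trans hA.le
      rw [enorm_le_coe] at h1
      exact_mod_cast h1
    obtain ⟨C, m, hC, hb⟩ := exists_norm_toLp_fourierInv_smulLeftCLM_pow_le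
      (hasTemperateGrowth_multiplier P) hA0 (𝓕 f) hK
    -- `C` may be `0`, whose roots do not tend to `1`; `C + 1` is positive.
    have hlim : Tendsto (fun n : ℕ => ENNReal.ofReal ((C + 1) ^ (1 / (n : ℝ)) *
        (((n : ℝ) + 1) ^ (1 / (n : ℝ))) ^ m * A)) atTop (𝓝 A) := by
      rw [← ENNReal.ofReal_coe_nnreal]
      refine (ENNReal.continuous_ofReal.tendsto _).comp ?_
      simpa using (((tendsto_const_rpow_one_div (by positivity : 0 < C + 1)).mul
        (tendsto_add_one_rpow_one_div.pow m)).mul_const (A : ℝ))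
    filter_upwards [hlim.eventually (gt_mem_nhds hAb), eventually_gt_atTop 0] with n hn hn0
    refine lt_of_le_of_lt ?_ hn
    rw [← ofReal_norm, ENNReal.ofReal_rpow_of_nonneg (norm_nonneg _) (by positivity)]
    apply ENNReal.ofReal_le_ofReal
    rw [diffOp_pow_eq_fourierInv]
    calc _ ≤ ((C + 1) * ((n : ℝ) + 1) ^ m * (A : ℝ) ^ n) ^ (1 / (n : ℝ)) := by
          gcongr
          refine (hb n).trans ?_
          gcongr
          linarith
      _ = _ := by
          rw [Real.mul_rpow (by positivity) (by positivity),
            Real.mul_rpow (by positivity) (by positivity), one_div,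
            Real.pow_rpow_inv_natCast hA0.le hn0.ne', ← Real.rpow_natCast, ← Real.rpow_natCast,
            ← Real.rpow_mul (by positivity), ← Real.rpow_mul (by positivity), mul_comm (m : ℝ)]

/-! ### Change of Fourier normalization and the two suprema. -/

theorem fourierTr_eq (f : 𝓢(Euc d, ℂ)) (ξ : Euc d) :
    fourierTr f ξ = (((2 * Real.pi) ^ (-(d : ℝ) / 2) : ℝ) : ℂ) * 𝓕 f ((2 * Real.pi)⁻¹ • ξ) := by
  rw [fourierTr, SchwartzMap.fourier_coe, Real.fourier_eq']
  congr 1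
  refine integral_congr_ae (Eventually.of_forall fun x => ?_)
  simp only [smul_eq_mul]
  rw [mul_comm]
  congr 2
  simp only [PiLp.inner_apply, PiLp.smul_apply, RCLike.inner_apply, conj_trivial, smul_eq_mul]
  have : ∑ j, (2 * Real.pi)⁻¹ * ξ j * x j = (2 * Real.pi)⁻¹ * ∑ j, ξ j * x j := by
    rw [Finset.mul_sum]
    exact Finset.sum_congr rfl fun j _ => by ring
  rw [this]
  have hpi : (Real.pi : ℂ) ≠ 0 := by exact_mod_cast Real.pi_ne_zero
  push_cast
  field_simp

/-- The two transforms differ by a nonzero constant and a dilation, which is a homeomorphism and so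
commutes with closure. -/
theorem tsupport_fourierTr (f : 𝓢(Euc d, ℂ)) :
    tsupport (fourierTr f) = (fun ξ : Euc d => (2 * Real.pi) • ξ) '' tsupport (𝓕 f : 𝓢(Euc d, ℂ)) := by
  have h2 : (2 * Real.pi) ≠ 0 := by positivity
  have hs : Function.support (fourierTr f) =
      (Homeomorph.smulOfNeZero (2 * Real.pi) h2 : Euc d ≃ₜ Euc d) '' Function.support (𝓕 f : 𝓢(Euc d, ℂ)) := by
    rw [Homeomorph.image_eq_preimage_symm]
    ext ξ
    have hc : (((2 * Real.pi) ^ (-(d : ℝ) / 2) : ℝ) : ℂ) ≠ 0 := by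
      exact_mod_cast (Real.rpow_pos_of_pos (by positivity) _).ne'
    rw [Function.mem_support, fourierTr_eq, mul_ne_zero_iff, and_iff_right hc]
    rfl
  rw [tsupport, hs, ← Homeomorph.image_closure]
  rfl

theorem symbol_image_tsupport_fourierTr (f : 𝓢(Euc d, ℂ)) :
    symbol P '' tsupport (fourierTr f) = multiplier P '' tsupport (𝓕 f : 𝓢(Euc d, ℂ)) := by
  rw [tsupport_fourierTr, Set.image_image]
  rfl

/-- Sublevel sets of the norm are closed. -/
theorem iSup_enorm_closure {E : Type*} [SeminormedAddCommGroup E] (s : Set E) :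
    ⨆ z ∈ closure s, ‖z‖ₑ = ⨆ z ∈ s, ‖z‖ₑ := by
  apply le_antisymm
  · refine iSup₂_le fun z hz => ?_
    have hc : IsClosed {w : E | ‖w‖ₑ ≤ ⨆ z ∈ s, ‖z‖ₑ} :=
      isClosed_le continuous_enorm continuous_const
    exact hc.closure_subset_iff.2 (fun w hw => le_iSup₂ (f := fun z _ => ‖z‖ₑ) w hw) hz
  · exact biSup_mono fun z hz => subset_closure hz

end LocalSpectrum

theorem mainTheorem12 (d : ℕ) (P : MvPolynomial (Fin d) ℂ) :
    (closedExt P).IsClosed ∧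
    HasSVEP (closedExt P) ∧
    ∀ f : 𝓢(Euc d, ℂ),
      (∃ h : f.toLp 1 volume ∈ (closedExt P).domain,
        closedExt P ⟨f.toLp 1 volume, h⟩ = (diffOp P f).toLp 1 volume) ∧
      localSpectrum (closedExt P) (f.toLp 1 volume) =
        closure (symbol P '' tsupport (fourierTr f)) ∧
      ∃ h : ∀ n : ℕ, f.toLp 1 volume ∈ (unbPow (closedExt P) n).domain,
        (∀ n : ℕ, unbPow (closedExt P) n ⟨f.toLp 1 volume, h n⟩ =
          ((diffOp P ^ n) f).toLp 1 volume) ∧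
        Tendsto (fun n : ℕ =>
            ‖unbPow (closedExt P) n ⟨f.toLp 1 volume, h n⟩‖ₑ ^ (1 / (n : ℝ))) atTop
          (𝓝 (⨆ ξ ∈ tsupport (fourierTr f), ‖symbol P ξ‖ₑ)) ∧
        Tendsto (fun n : ℕ =>
            ‖unbPow (closedExt P) n ⟨f.toLp 1 volume, h n⟩‖ₑ ^ (1 / (n : ℝ))) atTop
          (𝓝 (⨆ z ∈ localSpectrum (closedExt P) (f.toLp 1 volume), ‖z‖ₑ)) := by
  refine ⟨isClosed_closedExt P, hasSVEP_closedExt P, fun f => ⟨closedExt_toLp P f, ?_, ?_⟩⟩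
  · rw [localSpectrum_closedExt_toLp, symbol_image_tsupport_fourierTr]
  · refine ⟨fun n => (unbPow_closedExt_toLp P f n).1, fun n => (unbPow_closedExt_toLp P f n).2,
      ?_, ?_⟩
    · simp only [(unbPow_closedExt_toLp P f _).2]
      rw [tsupport_fourierTr, iSup_image]
      exact tendsto_enorm_diffOp_pow P f
    · simp only [(unbPow_closedExt_toLp P f _).2]
      rw [localSpectrum_closedExt_toLp, iSup_enorm_closure, iSup_image]
      exact tendsto_enorm_diffOp_pow P f

end
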